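/- Let $S$ be a complete separable metric space and $(\Omega,\mathcal F,P)$ a probability space. Write $x_{(\beta)}=\Gamma(x+\beta)/\Gamma(x)$ for $x>0$, $\beta\ge 0$, with $0_{(0)}=1$ and $0_{(n)}=0$ for integers $n\ge 1$. A point process on a metric space $X$ is a measurable map $N$ from $\Omega$ into the boundedly finite, integer-valued Borel measures on $X$. For $a,k,\rho>0$ and a boundedly finite Borel measure $\mu$ on $X$, a point process $N$ on $X$ is a generalized Waring process (GWP) with parameters $a,k,\rho$ and parameter measure $\mu$ if for all disjoint bounded Borel sets $A_1,\dots,A_l$ and all $n_1,\dots,n_l\in\{0,1,2,\dots\}$ $$P\{N(A_i)=n_i,\ i=1,\dots,l\}=\frac{\rho_{(k\sum_i\mu(A_i))}\,a_{(\sum_i n_i)}}{(\rho+a)_{(k\sum_i\mu(A_i)+\sum_i n_i)}}\prod_{i=1}^{l}\frac{(k\mu(A_i))_{(n_i)}}{n_i!}.$$ When $k$ is not mentioned, $k=1$. Given measures $\mu_1,\dots,\mu_m$ on $S$, let $\mu_1\oplus\dots\oplus\mu_m$ be the measure on $S\times\{1,\dots,m\}$ with value $\mu_i(A)$ at $A\times\{i\}$;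 a collection $\{N_1,\dots,N_m\}$ of processes on $S$ is identified in the same way with the process $N_1\oplus\dots\oplus N_m$ on $S\times\{1,\dots,m\}$. For a boundedly finite Borel measure $\mu$ on $S$, a multivariate GWP with parameters $a,k,\rho$ and parameter measure $\mu$ is a GWP on $S\times\{1,\dots,m\}$ with parameters $a,k,\rho$ and parameter measure $\mu\oplus\dots\oplus\mu$. A pair $\{N_1,N_2\}$ is a bivariate GWP with parameters $a,\rho$ and parameter measures $\mu_1,\mu_2$ if $N_1\oplus N_2$ is a GWP on $S\times\{1,2\}$ with parameters $a,\rho$ (and $k=1$) and parameter measure $\mu_1\oplus\mu_2$. Theorem. Let $N$ be a multivariate GWP on $S\times\{1,\dots,m\}$ with parameters $a,k,\rho$ and parameter measure $\mu$ on $S$, and let $N_i(\cdot)=N(\cdot\times\{i\})$. Then: 1. For every $i\in\{1,\dots,m\}$, the marginal $N_i$ is a GWP on $S$ with parameters $a,k,\rho$ and parameter measure $\mu$. 2. For all distinct indices $i_1,\dots,i_l\in\{1,\dots,m\}$, the sum $\sum_{j=1}^{l}N_{i_j}$ is a GWP on $S$ with parameters $a,\rho$ and parameter measure $kl\mu$.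 3. For all distinct indices $i_1,\dots,i_l\in\{1,\dots,m\}$, the collection $\{N_{i_1},\dots,N_{i_l}\}$ is a multivariate GWP with parameters $a,k,\rho$ and parameter measure $\mu$. 4. For every $i\in\{1,\dots,m\}$, the pair $\{N_i,\sum_{j\ne i}N_j\}$ is a bivariate GWP with parameters $a,\rho$ and parameter measures $k\mu$ and $(m-1)k\mu$. -/

import Mathlib

open MeasureTheory Set
open scoped Nat

noncomputable section

/-- The discrete space `{1, …, m}` as a metric space, with `dist i j = |i - j|`; the topology is the
discrete one.  With it, `S × Fin m` carries the product (maximum) metric, and a subset of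
`S × Fin m` is bounded exactly when its projection to `S` is bounded. -/
instance instMetricSpaceFin (m : ℕ) : MetricSpace (Fin m) :=
  (MetricSpace.induced (fun i : Fin m => (i : ℕ)) Fin.val_injective inferInstance).replaceTopology
    ((DiscreteTopology.eq_bot (α := Fin m)).trans
      (@DiscreteTopology.of_continuous_injective _ _ (TopologicalSpace.induced _ _) _ _ _
        continuous_induced_dom (Fin.val_injective (n := m))).eq_bot.symm)

/-- The ratio `x_(β) = Γ(x + β) / Γ(x)` for `x > 0` and real `β ≥ 0`. -/
def gammaRatio (x β : ℝ) : ℝ := Real.Gamma (x + β) / Real.Gamma x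

/-- The rising factorial `x_(n) = x (x + 1) ⋯ (x + n - 1)` for natural `n`, defined for every
`x ≥ 0` (in particular `0_(0) = 1` and `0_(n) = 0` for `n ≥ 1`). -/
def rising (x : ℝ) (n : ℕ) : ℝ := (ascPochhammer ℝ n).eval x

/-- For `x > 0` and natural exponents the two notations agree. -/
theorem gammaRatio_natCast {x : ℝ} (hx : 0 < x) (n : ℕ) : gammaRatio x n = rising x n := by
  unfold gammaRatio rising
  have h0 : Real.Gamma x ≠ 0 := (Real.Gamma_pos_of_pos hx).ne'
  induction n with
  | zero => simp [h0]
  | succ n ih =>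
    have hxn : x + n ≠ 0 := by positivity
    rw [ascPochhammer_succ_eval, ← ih]
    push_cast
    rw [← add_assoc, Real.Gamma_add_one hxn]
    ring

/-- The probability function of the multivariate generalized Waring distribution
`MGWD(a; k₁, …, k_s; ρ)` at `(x₁, …, x_s)`. -/
def mgwdPMF {s : ℕ} (a : ℝ) (k : Fin s → ℝ) (ρ : ℝ) (x : Fin s → ℕ) : ℝ :=
  gammaRatio ρ (∑ i, k i) * rising a (∑ i, x i)
      / gammaRatio (ρ + a) ((∑ i, k i) + ((∑ i, x i : ℕ) : ℝ))
    * ∏ i, rising (k i) (x i) / ((x i)! : ℝ)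

/-- A boundedly finite measure: finite on all bounded Borel sets. -/
def BoundedlyFinite {X : Type*} [MetricSpace X] [MeasurableSpace X] (μ : Measure X) : Prop :=
  ∀ B : Set X, Bornology.IsBounded B → MeasurableSet B → μ B < ⊤

/-- A point process: a measurable map into the boundedly finite, integer-valued measures.
The σ-algebra on measures is the one generated by the evaluations `ν ↦ ν B`. -/
structure IsPointProcess {Ω X : Type*} [MeasurableSpace Ω] [MetricSpace X] [MeasurableSpace X]
    (N : Ω → Measure X) : Prop where
  measurable : Measurable N
  integer_valued : ∀ ω, ∀ B : Set X, Bornology.IsBounded B → MeasurableSet B →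
    ∃ n : ℕ, N ω B = n

/-- `N` is a generalized Waring process on `X`, over the probability space `(Ω, P)`, with parameters
`a, k, ρ > 0` and parameter measure `μ`: the joint distribution of `N(A₁), …, N(A_l)` for disjoint
bounded Borel sets is `MGWD(a; kμ(A₁), …, kμ(A_l); ρ)`. -/
structure IsGWP {Ω X : Type*} [MeasurableSpace Ω] [MetricSpace X] [MeasurableSpace X]
    (P : Measure Ω) (N : Ω → Measure X) (a k ρ : ℝ) (μ : Measure X) : Prop where
  a_pos : 0 < a
  k_pos : 0 < k
  rho_pos : 0 < ρ
  boundedlyFinite : BoundedlyFinite μ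
  isPointProcess : IsPointProcess N
  fidi : ∀ (l : ℕ) (A : Fin l → Set X),
    (∀ i, Bornology.IsBounded (A i)) → (∀ i, MeasurableSet (A i)) →
    (∀ i j, i ≠ j → Disjoint (A i) (A j)) →
    ∀ n : Fin l → ℕ,
      P.real {ω | ∀ i, N ω (A i) = (n i : ENNReal)}
        = mgwdPMF a (fun i => k * μ.real (A i)) ρ n

/-- The measure on `S × {1, …, m}` whose restriction to the `i`-th copy `S × {i}` of `S` is `μ i`. -/
def assemble {S : Type*} [MeasurableSpace S] {m : ℕ} (μ : Fin m → Measure S) :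
    Measure (S × Fin m) :=
  ∑ i, (μ i).map (fun s => (s, i))

/-- The `i`-th marginal `A ↦ M (A × {i})` of a measure `M` on `S × {1, …, m}`. -/
def marginal {S : Type*} [MeasurableSpace S] {m : ℕ} (i : Fin m) (M : Measure (S × Fin m)) :
    Measure S :=
  (M.restrict (univ ×ˢ {i})).map Prod.fst

theorem marginal_apply {S : Type*} [MeasurableSpace S] {m : ℕ} (i : Fin m)
    (M : Measure (S × Fin m)) {A : Set S} (hA : MeasurableSet A) :
    marginal i M A = M (A ×ˢ {i}) := by
  unfold marginal
  rw [Measure.map_apply measurable_fst hA, Measure.restrict_apply (measurable_fst hA)]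
  congr 1
  ext ⟨s, j⟩
  simp

theorem assemble_prod {S : Type*} [MeasurableSpace S] {m : ℕ} (μ : Fin m → Measure S)
    {A : Set S} (hA : MeasurableSet A) (i : Fin m) :
    assemble μ (A ×ˢ {i}) = μ i A := by
  have hm : ∀ j : Fin m, Measurable (fun s : S => (s, j)) := fun j => by fun_prop
  unfold assemble
  rw [Measure.finsetSum_apply, Finset.sum_eq_single i]
  · rw [Measure.map_apply (hm i) (hA.prod (measurableSet_singleton i))]
    congr 1
    ext s
    simp
  · intro j _ hj
    rw [Measure.map_apply (hm j) (hA.prod (measurableSet_singleton i))]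
    have : (fun s : S => (s, j)) ⁻¹' (A ×ˢ {i}) = ∅ := by
      ext s
      simp [hj]
    rw [this, measure_empty]
  · simp

/-- `N` is a multivariate generalized Waring process with parameters `a, k, ρ` and parameter measure
`μ` on `S`: a generalized Waring process on `S × {1, …, m}` whose parameter measure `ν` puts a copy
of `μ` on each `S × {i}`, so that `ν (∑ A_i × {c_i}) = ∑ μ (A_i)`. -/
structure IsMultivariateGWP {Ω S : Type*} [MeasurableSpace Ω] [MetricSpace S] [MeasurableSpace S]
    (P : Measure Ω) {m : ℕ} (N : Ω → Measure (S × Fin m)) (a k ρ : ℝ) (μ : Measure S) : Prop where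
  boundedlyFinite : BoundedlyFinite μ
  isGWP : IsGWP P N a k ρ (assemble fun _ : Fin m => μ)

/-- The pair `(N₁, N₂)` is a bivariate generalized Waring process with parameters `a, ρ` and parameter
measures `μ₁, μ₂`: seen as one process on `S × {1, 2}`, it is a generalized Waring process whose
parameter measure is `μ₁` on the first copy of `S` and `μ₂` on the second one. -/
def IsBivariateGWP {Ω S : Type*} [MeasurableSpace Ω] [MetricSpace S] [MeasurableSpace S]
    (P : Measure Ω) (N₁ N₂ : Ω → Measure S) (a ρ : ℝ) (μ₁ μ₂ : Measure S) : Prop :=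
  IsGWP P (fun ω => assemble ![N₁ ω, N₂ ω]) a 1 ρ (assemble ![μ₁, μ₂])

end

/-!
The theorem needs no computation with the generalized Waring distribution. The defining formula of a
generalized Waring process `N` on `X` is required for *all* families of disjoint bounded Borel sets.
Hence, if `T` sends Borel sets of `Y` to Borel sets of `X` and preserves boundedness and
disjointness, every process on `Y` of the form `N' B = N (T B)` inherits the formula, with a
parameter measure `ν'` such that `k' ν' B = k ν (T B)` (`IsGWP.of_setMap`).

Every process in the theorem has this form. A sum of marginals over a set `J` of indices is
`A ↦ N (A × J)`, and a parameter measure with the copy `μ` on each `S × {i}` has mass `#J • μ A`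
there (`IsMultivariateGWP.isGWP_sum_marginal`). A family of such sums over disjoint sets `J j` is,
as a process on `S × {1, …, l}`, the map `B ↦ N (⋃ j, B_j × J j)`, where `B_j` is the `j`-th section
of `B`; disjointness of the `J j` makes the sets `B_j × J j` disjoint
(`IsMultivariateGWP.isGWP_assemble_sum_marginal`). The four assertions are special choices of the
index sets.
-/

open scoped Finset Function

/-- Transport of a generalized Waring process along a map `T` of sets, in the direction of a
preimage. Only the products of the scale `k` with the parameter measure enter the law, so the scale
may be changed along with the measure. -/
theorem IsGWP.of_setMap {Ω X Y : Type*} [MeasurableSpace Ω] [MetricSpace X] [MeasurableSpace X]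
    [MetricSpace Y] [MeasurableSpace Y] {P : Measure Ω} {N : Ω → Measure X} {N' : Ω → Measure Y}
    {a k k' ρ : ℝ} {ν : Measure X} {ν' : Measure Y} (hN : IsGWP P N a k ρ ν) (hk' : 0 < k')
    (T : Set Y → Set X) (hTm : ∀ B, MeasurableSet B → MeasurableSet (T B))
    (hTb : ∀ B, Bornology.IsBounded B → Bornology.IsBounded (T B))
    (hTd : ∀ B C, Disjoint B C → Disjoint (T B) (T C))
    (hN' : ∀ ω B, MeasurableSet B → N' ω B = N ω (T B))
    (hν' : ∀ B, MeasurableSet B →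
      ENNReal.ofReal k' * ν' B = ENNReal.ofReal k * ν (T B)) :
    IsGWP P N' a k' ρ ν' where
  a_pos := hN.a_pos
  k_pos := hk'
  rho_pos := hN.rho_pos
  boundedlyFinite B hb hm := by
    have h : ENNReal.ofReal k' * ν' B < ⊤ := by
      rw [hν' B hm]
      exact ENNReal.mul_lt_top ENNReal.ofReal_lt_top
        (hN.boundedlyFinite _ (hTb B hb) (hTm B hm))
    exact ENNReal.lt_top_of_mul_ne_top_right h.ne (ENNReal.ofReal_pos.2 hk').ne'
  isPointProcess :=
    { measurable := by
        refine Measure.measurable_of_measurable_coe _ fun B hm => ?_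
        simp only [hN' _ B hm]
        exact (Measure.measurable_coe (hTm B hm)).comp hN.isPointProcess.measurable
      integer_valued := fun ω B hb hm => by
        rw [hN' ω B hm]
        exact hN.isPointProcess.integer_valued ω _ (hTb B hb) (hTm B hm) }
  fidi l A hb hm hd n := by
    have hreal : ∀ i, k' * ν'.real (A i) = k * ν.real (T (A i)) := fun i => by
      have h := congrArg ENNReal.toReal (hν' (A i) (hm i))
      rwa [ENNReal.toReal_mul, ENNReal.toReal_mul, ENNReal.toReal_ofReal hk'.le,
        ENNReal.toReal_ofReal hN.k_pos.le] at h
    simp only [hN' _ _ (hm _), hreal]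
    exact hN.fidi l (fun i => T (A i)) (fun i => hTb _ (hb i)) (fun i => hTm _ (hm i))
      (fun i j hij => hTd _ _ (hd i j hij)) n

section Product

variable {S : Type*} [MeasurableSpace S] {m : ℕ}

theorem sum_marginal_apply (M : Measure (S × Fin m)) (J : Finset (Fin m)) {A : Set S}
    (hA : MeasurableSet A) : (∑ i ∈ J, marginal i M) A = M (A ×ˢ (J : Set (Fin m))) := by
  have hJ : A ×ˢ (J : Set (Fin m)) = ⋃ i ∈ J, A ×ˢ ({i} : Set (Fin m)) := by
    ext ⟨s, i⟩
    simp
  rw [hJ, measure_biUnion_finset]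
  · simp only [Measure.finsetSum_apply, marginal_apply _ _ hA]
  · intro i _ j _ hij
    exact Set.disjoint_prod.2 (Or.inr (Set.disjoint_singleton.2 hij))
  · exact fun i _ => hA.prod (measurableSet_singleton i)

theorem marginal_assemble (μ : Fin m → Measure S) (i : Fin m) :
    marginal i (assemble μ) = μ i := by
  ext A hA
  rw [marginal_apply i _ hA, assemble_prod μ hA i]

theorem assemble_const_prod (μ : Measure S) (J : Finset (Fin m)) {A : Set S}
    (hA : MeasurableSet A) :
    assemble (fun _ : Fin m => μ) (A ×ˢ (J : Set (Fin m))) = (#J : ENNReal) * μ A := by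
  rw [← sum_marginal_apply _ J hA]
  simp [marginal_assemble]

theorem assemble_apply (μ : Fin m → Measure S) {B : Set (S × Fin m)} (hB : MeasurableSet B) :
    assemble μ B = ∑ j, μ j ((fun s => (s, j)) ⁻¹' B) := by
  unfold assemble
  rw [Measure.finsetSum_apply]
  exact Finset.sum_congr rfl fun j _ => Measure.map_apply measurable_prodMk_right hB

/-- The subset of `S × {1, …, m}` obtained from `B ⊆ S × {1, …, l}` by replacing each index `j`
with the set of indices `J j`. -/
def blowUp {S : Type*} {l m : ℕ} (J : Fin l → Finset (Fin m)) (B : Set (S × Fin l)) :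
    Set (S × Fin m) :=
  ⋃ j, ((fun s => (s, j)) ⁻¹' B) ×ˢ (J j : Set (Fin m))

theorem measurableSet_blowUp {l : ℕ} (J : Fin l → Finset (Fin m)) {B : Set (S × Fin l)}
    (hB : MeasurableSet B) : MeasurableSet (blowUp J B) :=
  MeasurableSet.iUnion fun j =>
    (measurable_prodMk_right hB).prod (J j).measurableSet

theorem measure_blowUp {l : ℕ} {J : Fin l → Finset (Fin m)} (hJ : Pairwise (Disjoint on J))
    (M : Measure (S × Fin m)) {B : Set (S × Fin l)} (hB : MeasurableSet B) :
    M (blowUp J B) = ∑ j, M (((fun s => (s, j)) ⁻¹' B) ×ˢ (J j : Set (Fin m))) := by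
  rw [blowUp, measure_iUnion, tsum_fintype]
  · exact fun i j hij => Set.disjoint_prod.2 (Or.inr (Finset.disjoint_coe.2 (hJ hij)))
  · exact fun j => (measurable_prodMk_right hB).prod (J j).measurableSet

theorem disjoint_blowUp {S : Type*} {l : ℕ} {J : Fin l → Finset (Fin m)}
    (hJ : Pairwise (Disjoint on J)) {B C : Set (S × Fin l)} (h : Disjoint B C) :
    Disjoint (blowUp J B) (blowUp J C) := by
  refine Set.disjoint_iUnion_left.2 fun i => Set.disjoint_iUnion_right.2 fun j =>
    Set.disjoint_prod.2 ?_
  rcases eq_or_ne i j with rfl | hij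
  · exact Or.inl (h.preimage _)
  · exact Or.inr (Finset.disjoint_coe.2 (hJ hij))

theorem isBounded_blowUp {S : Type*} [MetricSpace S] {l : ℕ} (J : Fin l → Finset (Fin m))
    {B : Set (S × Fin l)} (hB : Bornology.IsBounded B) : Bornology.IsBounded (blowUp J B) := by
  refine (hB.image_fst.prod (Set.toFinite (univ : Set (Fin m))).isBounded).subset ?_
  refine Set.iUnion_subset fun j => Set.prod_mono (fun s hs => ?_) (Set.subset_univ _)
  exact ⟨(s, j), hs, rfl⟩

end Product

namespace IsMultivariateGWP

variable {Ω S : Type*} [MeasurableSpace Ω] [MetricSpace S] [MeasurableSpace S] {P : Measure Ω}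
  {m : ℕ} {N : Ω → Measure (S × Fin m)} {a k k' ρ : ℝ} {μ : Measure S}

/-- The sum of the marginals over an index set `J` is a generalized Waring process, since it is
`A ↦ N (A × J)`. -/
theorem isGWP_sum_marginal (hN : IsMultivariateGWP P N a k ρ μ) (hk' : 0 < k')
    (J : Finset (Fin m)) {c : ENNReal} (hc : ENNReal.ofReal k' * c = ENNReal.ofReal k * #J) :
    IsGWP P (fun ω => ∑ i ∈ J, marginal i (N ω)) a k' ρ (c • μ) := by
  refine hN.isGWP.of_setMap hk' (fun A => A ×ˢ (J : Set (Fin m)))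
    (fun A hA => hA.prod J.measurableSet) (fun A hA => hA.prod (Set.toFinite _).isBounded)
    (fun A B h => Set.disjoint_prod.2 (Or.inl h))
    (fun ω A hA => sum_marginal_apply _ J hA) fun A hA => ?_
  rw [assemble_const_prod μ J hA, Measure.smul_apply, smul_eq_mul, ← mul_assoc, hc, mul_assoc]

/-- The sums of the marginals over disjoint index sets `J j` jointly form a generalized Waring
process. -/
theorem isGWP_assemble_sum_marginal (hN : IsMultivariateGWP P N a k ρ μ) (hk' : 0 < k')
    {l : ℕ} {J : Fin l → Finset (Fin m)} (hJ : Pairwise (Disjoint on J)) {c : Fin l → ENNReal}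
    (hc : ∀ j, ENNReal.ofReal k' * c j = ENNReal.ofReal k * #(J j)) :
    IsGWP P (fun ω => assemble fun j => ∑ i ∈ J j, marginal i (N ω)) a k' ρ
      (assemble fun j => c j • μ) := by
  refine hN.isGWP.of_setMap hk' (blowUp J) (fun B => measurableSet_blowUp J)
    (fun B => isBounded_blowUp J) (fun B C => disjoint_blowUp hJ) (fun ω B hB => ?_)
    fun B hB => ?_
  · rw [measure_blowUp hJ _ hB, assemble_apply _ hB]
    exact Finset.sum_congr rfl fun j _ =>
      sum_marginal_apply _ (J j) (measurable_prodMk_right hB)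
  · rw [measure_blowUp hJ _ hB, assemble_apply _ hB, Finset.mul_sum, Finset.mul_sum]
    refine Finset.sum_congr rfl fun j _ => ?_
    rw [assemble_const_prod μ (J j) (measurable_prodMk_right hB), Measure.smul_apply, smul_eq_mul,
      ← mul_assoc, hc, mul_assoc]

end IsMultivariateGWP

theorem theorem11 {Ω S : Type*} [MeasurableSpace Ω] (P : Measure Ω) [IsProbabilityMeasure P]
    [MetricSpace S] [CompleteSpace S] [TopologicalSpace.SeparableSpace S]
    [MeasurableSpace S] [BorelSpace S]
    (m : ℕ) (a k ρ : ℝ) (μ : Measure S) (N : Ω → Measure (S × Fin m))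
    (hN : IsMultivariateGWP P N a k ρ μ) :
    -- each marginal is a generalized Waring process
    (∀ i : Fin m, IsGWP P (fun ω => marginal i (N ω)) a k ρ μ) ∧
    -- sums of marginals over distinct indices
    (∀ (l : ℕ) (e : Fin l → Fin m), Function.Injective e →
      IsGWP P (fun ω => ∑ j, marginal (e j) (N ω)) a 1 ρ (ENNReal.ofReal (k * l) • μ)) ∧
    -- sub-collections of marginals over distinct indices
    (∀ (l : ℕ) (e : Fin l → Fin m), Function.Injective e →
      IsMultivariateGWP P (fun ω => assemble fun j => marginal (e j) (N ω)) a k ρ μ) ∧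
    -- one marginal together with the sum of all the others
    (∀ i : Fin m,
      IsBivariateGWP P (fun ω => marginal i (N ω))
        (fun ω => ∑ j ∈ Finset.univ.erase i, marginal j (N ω)) a ρ
        (ENNReal.ofReal k • μ) (ENNReal.ofReal (((m : ℝ) - 1) * k) • μ)) := by

  have hk := hN.isGWP.k_pos
  refine ⟨fun i => ?_, fun l e he => ?_, fun l e he => ⟨hN.boundedlyFinite, ?_⟩, fun i => ?_⟩
  · simpa using hN.isGWP_sum_marginal hk {i} (c := 1) (by simp)
  · have h := hN.isGWP_sum_marginal one_pos (Finset.univ.map ⟨e, he⟩)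
      (c := ENNReal.ofReal (k * l)) (by simp [ENNReal.ofReal_mul hk.le])
    simpa using h
  · have h := hN.isGWP_assemble_sum_marginal hk (J := fun j => {e j}) (c := fun _ => 1)
      (fun i j hij => Finset.disjoint_singleton.2 (he.ne hij)) (by simp)
    simpa using h
  · have hm : 1 ≤ m := i.pos
    have h := hN.isGWP_assemble_sum_marginal one_pos (J := ![{i}, Finset.univ.erase i])
      (c := ![ENNReal.ofReal k, ENNReal.ofReal (((m : ℝ) - 1) * k)])
      (by
        intro p q hpq
        fin_cases p <;> fin_cases q <;> simp_all [Function.onFun])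
      (by
        -- `m ≥ 1` because `i` exists, so the truncated `m - 1` counts the other indices correctly.
        have hcard : ENNReal.ofReal (((m : ℝ) - 1) * k) = ENNReal.ofReal k * ((m - 1 : ℕ)) := by
          rw [mul_comm, ENNReal.ofReal_mul hk.le, ← Nat.cast_pred hm, ENNReal.ofReal_natCast]
        intro j
        fin_cases j
        · simp
        · simpa using hcard)
    unfold IsBivariateGWP
    convert h using 3 with ω
    · funext j
      fin_cases j <;> simp
    · next j => fin_cases j <;> simp
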